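/- **Notation.** Let $U=\{z\in\mathbb C:|z|<1\}$ and $U^*=U\setminus\{0\}$. "Univalent in $U$" means analytic and injective in $U$; "convex univalent" means univalent with convex image. For functions $g,h$ on $U$, $g\prec h$ means that $g=h\circ\omega$ in $U$ for some analytic $\omega:U\to U$ with $\omega(0)=0$. $H[1,1]$ is the set of analytic functions on $U$ of the form $1+a_1z+a_2z^2+\cdots$. $Q$ is the set of functions $p$ on $U$ that extend to an analytic and injective function on $\overline U\setminus E(p)$, with $p'(\zeta)\ne0$ for $\zeta\in\partial U\setminus E(p)$, where $E(p)=\{\zeta\in\partial U:\lim_{z\to\zeta}p(z)=\infty\}$; analytic at a boundary point means analytic in a neighbourhood of it. Let $\alpha>0$ and $\beta\in\mathbb C\setminus\{0,-1,-2,\dots\}$. Let $f(z)=z^{-1}+\sum_{k\ge0}a_kz^k$ be analytic in $U^*$, and for $s\in\{\alpha,\alpha-1,\alpha-2\}$ put $$\mathcal P_\beta^{s}f(z)=\frac1z+\sum_{k=0}^\infty\Big(\frac{\beta}{k+\beta+1}\Big)^{s}a_kz^k\qquad(z\in U^*),$$ with principal powers. (For $s,\beta>0$ this is $\frac{\beta^s}{\Gamma(s)}z^{-\beta-1}\int_0^zt^\beta(\log\frac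 zt)^{s-1}f(t)\,dt$.) **Theorem.** Let $m\in\mathbb C$ and $\lambda,\mu,\ell\in\mathbb C\setminus\{0\}$ with $\operatorname{Re}(m\beta/\ell)<0$, and let $q$ be convex univalent in $U$ with $q(0)=1$. Put $$F(z)=\frac{(1-\lambda)z\mathcal P_\beta^{\alpha-1}f(z)+\lambda z\mathcal P_\beta^\alpha f(z)}{\lambda},$$ which has a removable singularity at $0$ with value $1/\lambda$. Suppose that $F(z)\neq0$ for $z\in U^*$, and let $p=F^\mu$ be any analytic branch of the power in $U$, i.e. $p=e^{\mu L}$ with $L$ analytic in $U$ and $e^L=F$. Suppose that $p\in H[1,1]\cap Q$, that the function $$\Phi(z)=p(z)\left[m+\mu\ell\,\frac{\lambda\mathcal P_\beta^\alpha f(z)+(1-2\lambda)\mathcal P_\beta^{\alpha-1}f(z)+(\lambda-1)\mathcal P_\beta^{\alpha-2}f(z)}{(1-\lambda)\mathcal P_\beta^{\alpha-1}f(z)+\lambda\mathcal P_\beta^\alpha f(z)}\right]$$ (extended analytically to $0$) is univalent in $U$, and that $$mq(z)-\frac{\ell}{\beta}zq'(z)\prec\Phi(z).$$ Then $q\prec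 p=F^\mu$, and $q$ is the best subordinant of the differential superordination $$mq(z)-\frac\ell\beta zq'(z)\prec m\,w(z)-\frac\ell\beta zw'(z).\qquad(*)$$ The latter means the following. A solution of $(*)$ is a univalent function $w$ on $U$ for which $mw-\frac\ell\beta zw'$ is univalent in $U$ and $(*)$ holds; a subordinant is an analytic function $r$ on $U$ with $r\prec w$ for every solution $w$; and $q$ is a univalent subordinant such that $r\prec q$ for every subordinant $r$. -/

import Mathlib

namespace MeroSandwich

open Complex MeasureTheory Set Filter Topology

/-- The open unit disk `U`. -/
abbrev U : Set ℂ := Metric.ball (0 : ℂ) 1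

/-- The punctured open unit disk `U*`. -/
abbrev Ustar : Set ℂ := U \ {0}

/-- `f` is analytic and injective in `U`. -/
def IsUnivalent (f : ℂ → ℂ) : Prop :=
  DifferentiableOn ℂ f U ∧ InjOn f U

/-- `f` is univalent in `U` and maps `U` onto a convex set. -/
def IsConvexUnivalent (f : ℂ → ℂ) : Prop :=
  IsUnivalent f ∧ Convex ℝ (f '' U)

/-- `g ≺ f`: there is a Schwarz function `ω` with `g = f ∘ ω` in `U`. -/
def Subord (g f : ℂ → ℂ) : Prop :=
  ∃ ω : ℂ → ℂ, DifferentiableOn ℂ ω U ∧ ω 0 = 0 ∧ (∀ z ∈ U, ‖ω z‖ < 1) ∧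
    ∀ z ∈ U, g z = f (ω z)

/-- The class `H[a, n]` of the functions `a + a_n z ^ n + a_{n+1} z ^ (n+1) + ⋯` analytic in `U`. -/
def ClassH (a : ℂ) (n : ℕ) : Set (ℂ → ℂ) :=
  {f | DifferentiableOn ℂ f U ∧
    ∃ c : ℕ → ℂ, ∀ z ∈ U, HasSum (fun k : ℕ => c k * z ^ (n + k)) (f z - a)}

/-- `E(q)`: the boundary points at which `q` tends to infinity from inside `U`. -/
def excSet (q : ℂ → ℂ) : Set ℂ :=
  {ζ | ‖ζ‖ = 1 ∧ Tendsto q (𝓝[U] ζ) (Bornology.cobounded ℂ)}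

/-- The class `Q`: the functions `q` on `U` that extend to a function which is analytic (in a
neighbourhood of every point) and injective on `closure U \ E(q)` and whose derivative does not
vanish on `∂U \ E(q)`. -/
def ClassQ : Set (ℂ → ℂ) :=
  {q | ∃ g : ℂ → ℂ, EqOn g q U ∧
    AnalyticOnNhd ℂ g (Metric.closedBall 0 1 \ excSet q) ∧
    InjOn g (Metric.closedBall 0 1 \ excSet q) ∧
    ∀ ζ ∈ Metric.sphere (0 : ℂ) 1 \ excSet q, deriv g ζ ≠ 0}

/-! ### Differential superordinations `h ≺ φ(p, z p', z² p''; z)` -/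

/-- The function `z ↦ φ(p(z), z p'(z), z² p''(z); z)`. -/
noncomputable def diffExpr (φ : ℂ → ℂ → ℂ → ℂ → ℂ) (p : ℂ → ℂ) (z : ℂ) : ℂ :=
  φ (p z) (z * deriv p z) (z ^ 2 * deriv (deriv p) z) z

/-- `p` is a solution of the differential superordination `h ≺ φ(p, z p', z² p''; z)`. -/
def IsSolution (φ : ℂ → ℂ → ℂ → ℂ → ℂ) (h p : ℂ → ℂ) : Prop :=
  IsUnivalent p ∧ IsUnivalent (diffExpr φ p) ∧ Subord h (diffExpr φ p)

/-- `q` is analytic in `U` and `q ≺ p` for all solutions `p`. -/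
def IsSubordinant (φ : ℂ → ℂ → ℂ → ℂ → ℂ) (h q : ℂ → ℂ) : Prop :=
  DifferentiableOn ℂ q U ∧ ∀ p, IsSolution φ h p → Subord q p

/-- `q` is a univalent subordinant, and `r ≺ q` for all subordinants `r`. -/
def IsBestSubordinant (φ : ℂ → ℂ → ℂ → ℂ → ℂ) (h q : ℂ → ℂ) : Prop :=
  IsUnivalent q ∧ IsSubordinant φ h q ∧ ∀ r, IsSubordinant φ h r → Subord r q

/-! ### The meromorphic functions and the integral operator -/

/-- `f` is analytic in `U*`, with `f(z) = 1 / z + ∑_{k ≥ 0} a_k z ^ k` there. -/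
def HasLaurent (f : ℂ → ℂ) (a : ℕ → ℂ) : Prop :=
  DifferentiableOn ℂ f Ustar ∧ ∀ z ∈ Ustar, HasSum (fun k : ℕ => a k * z ^ k) (f z - z⁻¹)

/-- The class of the functions `1 / z + ∑_{k ≥ 0} a_k z ^ k` analytic in `U*`. The functions
without a constant term form the subclass `a_0 = 0`. -/
def ClassSigma : Set (ℂ → ℂ) := {f | ∃ a : ℕ → ℂ, HasLaurent f a}

/-- The coefficient `a_k` of `f(z) = 1 / z + ∑ a_k z ^ k`, as the Taylor coefficient of order
`k + 1` at `0` of `z f(z)` (extended to `0` by the value `1`). -/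
noncomputable def coeff (f : ℂ → ℂ) (k : ℕ) : ℂ :=
  iteratedDeriv (k + 1) (Function.update (fun z => z * f z) 0 1) 0 / ((k + 1).factorial : ℂ)

/-- The operator `P_β^α f(z) = 1 / z + ∑_{k ≥ 0} (β / (k + β + 1)) ^ α a_k z ^ k`. The series has
a meaning for all real `α`; for `α > 0` and `β > 0` it is the integral operator, see
`opP_eq_integral`. -/
noncomputable def opP (α : ℝ) (β : ℂ) (f : ℂ → ℂ) (z : ℂ) : ℂ :=
  z⁻¹ + ∑' k : ℕ, (β / (k + β + 1)) ^ (α : ℂ) * coeff f k * z ^ k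

/-- The coefficients are the ones of the expansion of `f`. -/
theorem coeff_eq {f : ℂ → ℂ} {a : ℕ → ℂ} (hf : HasLaurent f a) (k : ℕ) : coeff f k = a k := by
  have h : HasFPowerSeriesAt (Function.update (fun z => z * f z) 0 1)
      (FormalMultilinearSeries.ofScalars ℂ
        (fun n : ℕ => Nat.casesOn (motive := fun _ => ℂ) n 1 a)) 0 := by
    rw [hasFPowerSeriesAt_iff]
    filter_upwards [Metric.ball_mem_nhds (0 : ℂ) one_pos] with z hz
    simp only [FormalMultilinearSeries.coeff_ofScalars, smul_eq_mul, zero_add]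
    by_cases h0 : z = 0
    · subst h0
      rw [Function.update_self]
      convert! hasSum_single (f := fun n : ℕ =>
        (0 : ℂ) ^ n * Nat.casesOn (motive := fun _ => ℂ) n 1 a) 0 ?_ using 1
      · simp
      · intro n hn
        simp [hn]
    · rw [Function.update_of_ne h0, ← hasSum_nat_add_iff' 1]
      have := (hf.2 z ⟨hz, h0⟩).mul_left z
      convert! this using 1
      · funext n
        simp only [pow_succ]
        ring
      · simp only [Finset.range_one, Finset.sum_singleton, pow_zero]
        rw [mul_sub, mul_inv_cancel₀ h0, one_mul]
        rfl
  obtain ⟨r, hr⟩ := h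
  have h2 := hr.factorial_smul 1 (k + 1)
  rw [← iteratedDeriv_eq_iteratedFDeriv] at h2
  rw [coeff, ← h2]
  have : ((k + 1).factorial : ℂ) ≠ 0 := by exact_mod_cast (k + 1).factorial_ne_zero
  simp
  field_simp

/-- For `α, β > 0` the operator is the integral operator
`β ^ α / Γ(α) z ^ (-β-1) ∫_0^z t ^ β (log (z / t)) ^ (α-1) f(t) dt`, where the integral is taken
along the segment `t = s z`. -/
theorem opP_eq_integral {f : ℂ → ℂ} (hf : f ∈ ClassSigma) {α β : ℝ} (hα : 0 < α)
    (hβ : 0 < β) {z : ℂ} (hz : z ∈ Ustar) :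
    opP α β f z = ((β ^ α / Real.Gamma α : ℝ) : ℂ) *
      ∫ s in (0 : ℝ)..1, ((s ^ β * Real.log (1 / s) ^ (α - 1) : ℝ) : ℂ) * f (s * z) := by
  obtain ⟨a, ha⟩ := hf
  have hz0 : z ≠ 0 := hz.2
  have hzn : ‖z‖ < 1 := by simpa using hz.1
  set b : ℕ → ℂ := fun n => Nat.casesOn (motive := fun _ => ℂ) n 1 a with hb
  have hser : ∀ w ∈ Ustar, HasSum (fun n => b n * w ^ n) (w * f w) := by
    intro w hw
    have hw0 : w ≠ 0 := hw.2
    rw [← hasSum_nat_add_iff' 1]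
    convert! (ha.2 w hw).mul_left w using 1
    · funext n
      simp only [hb, pow_succ]
      ring
    · simp only [Finset.range_one, Finset.sum_singleton, pow_zero, hb]
      rw [mul_sub, mul_inv_cancel₀ hw0, mul_one]
      rfl
  have hmem : ∀ t : ℝ, 0 < t → (Real.exp (-t) : ℂ) * z ∈ Ustar := by
    intro t ht
    refine ⟨?_, ?_⟩
    · simp only [Metric.mem_ball, dist_zero_right, norm_mul, Complex.norm_real, Real.norm_eq_abs,
        Real.abs_exp]
      have : Real.exp (-t) < 1 := by simpa using ht
      nlinarith [Real.exp_pos (-t), norm_nonneg z]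
    · simp [hz0]
  set F : ℝ → ℂ := fun t => (Real.exp (-(β * t)) : ℂ) *
    ((Real.exp (-t) : ℂ) * z * f ((Real.exp (-t) : ℂ) * z)) with hF
  have hM : HasSum (fun n : ℕ => Complex.Gamma α * (b n * z ^ n) / ((β + n : ℝ) : ℂ) ^ (α : ℂ))
      (mellin F α) := by
    apply hasSum_mellin (p := fun n : ℕ => β + n)
    · intro n; right; positivity
    · simpa using hα
    · intro t ht
      convert! (hser _ (hmem t ht)).mul_left (Real.exp (-(β * t)) : ℂ) using 1
      funext n
      rw [show -(β + n) * t = -(β * t) + n * (-t) by ring, Real.exp_add, Real.exp_nat_mul]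
      push_cast
      rw [mul_pow]
      ring
    · have h1 : Summable fun n => ‖b n * z ^ n‖ / β ^ α := ((hser z hz).summable.norm).div_const _
      refine h1.of_nonneg_of_le (fun n => by positivity) (fun n => ?_)
      simp only [ofReal_re]
      gcongr
      simp
  have hI : z * ∫ s in (0 : ℝ)..1, ((s ^ β * Real.log (1 / s) ^ (α - 1) : ℝ) : ℂ) * f (s * z)
      = mellin F α := by
    have himg : (fun t : ℝ => Real.exp (-t)) '' Ioi 0 = Ioo 0 1 := by
      ext s
      constructor
      · rintro ⟨t, ht, rfl⟩
        exact ⟨Real.exp_pos _, by simpa using ht⟩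
      · rintro ⟨h0, h1⟩
        exact ⟨-Real.log s, by simpa using Real.log_neg h0 h1, by simp [Real.exp_log h0]⟩
    rw [intervalIntegral.integral_of_le zero_le_one, integral_Ioc_eq_integral_Ioo, ← himg,
      integral_image_eq_integral_abs_deriv_smul (f' := fun t => -Real.exp (-t)) measurableSet_Ioi
      (fun t _ => by simpa using ((hasDerivAt_neg t).exp).hasDerivWithinAt)
      (fun x _ y _ h => by simpa using h), ← integral_const_mul, mellin]
    refine setIntegral_congr_fun measurableSet_Ioi fun t ht => ?_
    have ht0 : (0 : ℝ) ≤ t := le_of_lt ht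
    have h1 : Real.log (1 / Real.exp (-t)) = t := by simp
    have h2 : Real.exp (-t) ^ β = Real.exp (-(β * t)) := by
      rw [← Real.exp_mul]; ring_nf
    have h3 : (t : ℂ) ^ ((α : ℂ) - 1) = ((t ^ (α - 1) : ℝ) : ℂ) := by
      rw [Complex.ofReal_cpow ht0]; push_cast; rfl
    simp only [h1, h2, h3, hF, abs_neg, Real.abs_exp, Complex.real_smul, smul_eq_mul]
    push_cast
    ring
  have hG : Real.Gamma α ≠ 0 := (Real.Gamma_pos_of_pos hα).ne'
  have hG' : Complex.Gamma α ≠ 0 := by rw [Complex.Gamma_ofReal]; exact_mod_cast hG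
  have hβα : ((β : ℂ)) ^ (α : ℂ) ≠ 0 := by
    rw [← Complex.ofReal_cpow hβ.le]; exact_mod_cast (Real.rpow_pos_of_pos hβ α).ne'
  have hS := hM.mul_left ((β : ℂ) ^ (α : ℂ) / Complex.Gamma α * z⁻¹)
  rw [← hI] at hS
  have hS' := (hasSum_nat_add_iff' 1).mpr hS
  have key : ∀ n : ℕ, (β : ℂ) ^ (α : ℂ) / Complex.Gamma α * z⁻¹ *
      (Complex.Gamma α * (b n * z ^ n) / ((β + n : ℝ) : ℂ) ^ (α : ℂ)) =
      ((β : ℂ) / ((β + n : ℝ) : ℂ)) ^ (α : ℂ) * b n * z ^ n * z⁻¹ := by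
    intro n
    rw [Complex.div_cpow_ofReal_nonneg hβ.le (by positivity)]
    field_simp
  simp only [key] at hS'
  rw [opP]
  have hterm : (fun k : ℕ => ((β : ℂ) / (k + β + 1)) ^ (α : ℂ) * coeff f k * z ^ k) =
      fun k : ℕ => ((β : ℂ) / ((β + (k + 1 : ℕ) : ℝ) : ℂ)) ^ (α : ℂ) * b (k + 1) * z ^ (k + 1)
        * z⁻¹ := by
    funext k
    rw [coeff_eq ha]
    have : ((β + (k + 1 : ℕ) : ℝ) : ℂ) = k + β + 1 := by push_cast; ring
    rw [this]
    simp only [hb, pow_succ]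
    field_simp
  rw [hterm, hS'.tsum_eq]
  have hβ0 : (β : ℂ) ≠ 0 := by exact_mod_cast hβ.ne'
  simp only [Finset.range_one, Finset.sum_singleton, show b 0 = 1 from rfl, pow_zero, Nat.cast_zero, add_zero,
    div_self hβ0, Complex.one_cpow]
  rw [Complex.ofReal_div, Complex.ofReal_cpow hβ.le, ← Complex.Gamma_ofReal]
  field_simp
  ring

/-- The function `((1 - λ) z P_β^{α-1} f(z) + λ z P_β^α f(z)) / λ`, for `z ∈ U*`. -/
noncomputable def baseFun (α : ℝ) (β lam : ℂ) (f : ℂ → ℂ) (z : ℂ) : ℂ :=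
  ((1 - lam) * z * opP (α - 1) β f z + lam * z * opP α β f z) / lam

/-- `p` is an analytic branch in `U` of the power `F ^ μ`, that is `p = exp (μ L)` for an analytic
function `L` in `U` with `exp L = F` (a branch of `log F`). As `F` is given by a formula with a
removable singularity at `0`, the identity `exp L = F` is required in `U*`. -/
def IsPowerBranch (F : ℂ → ℂ) (μ : ℂ) (p : ℂ → ℂ) : Prop :=
  ∃ L : ℂ → ℂ, DifferentiableOn ℂ L U ∧ (∀ z ∈ Ustar, Complex.exp (L z) = F z) ∧
    ∀ z ∈ U, p z = Complex.exp (μ * L z)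

/-- The expression `p(z) [m + μ ℓ (λ P_β^α f + (1 - 2 λ) P_β^{α-1} f + (λ - 1) P_β^{α-2} f) /
((1 - λ) P_β^{α-1} f + λ P_β^α f)]` for `z ∈ U*`, where `p` is the chosen power of `baseFun`. -/
noncomputable def phiExpr (α : ℝ) (β lam μ m l : ℂ) (f p : ℂ → ℂ) (z : ℂ) : ℂ :=
  p z * (m + μ * l *
    ((lam * opP α β f z + (1 - 2 * lam) * opP (α - 1) β f z + (lam - 1) * opP (α - 2) β f z) /
      ((1 - lam) * opP (α - 1) β f z + lam * opP α β f z)))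

end MeroSandwich

open MeroSandwich

namespace MeroSandwich

open Complex MeasureTheory Set Filter Topology

/-! Put `c = -l / β`. The operators satisfy `z (P^s f)' = β P^{s-1} f - (β + 1) P^s f`
(`hasDerivAt_opP`), so logarithmic differentiation of `F` turns `Φ` into `m p + c z p'`
(`phiExpr_eq`). Membership in `Q` makes `p` injective in the disc. What remains is a statement about
univalent functions, `subord_of_subord_add`: if `Re (m / c) > 0`, `q` is convex, and `w` and `W = m
w + c z w'` are univalent, then `m q + c z q' ≺ W` implies `q ≺ w`.

To prove it, compare the images of discs of the same radius `R < 1`, so that no boundary behaviour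
of `w` enters. Where `q(B_r)` first touches the boundary of `w(B_R)` from inside, say `q z = w ζ`,
Jack's lemma applied to `w⁻¹ ∘ q` gives `z q'(z) = k ζ w'(ζ)` with `k ≥ 1`. Hence `W ζ = m q z + k⁻¹
c z q'(z)`. Convexity of `q` shows that this is a value of `m q + c z q'` at some `x` with `|x| ≤
|z|` (`exists_norm_le_of_le_one`). That value is `W (ω x)`, so `ζ = ω x` and `R = |ζ| ≤ |z|` by
Schwarz: `q` cannot leave `w(B_R)` before radius `R`.

The subordinant is best because `q` is itself a solution, `m q + c z q'` being univalent
(`isUnivalent_add`). -/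

lemma isOpen_U : IsOpen U := Metric.isOpen_ball

lemma mem_U_iff {z : ℂ} : z ∈ U ↔ ‖z‖ < 1 := by simp

lemma zero_mem_U : (0 : ℂ) ∈ U := by simp

/-! ### Inverses of univalent functions and subordination -/

namespace IsUnivalent

variable {F : ℂ → ℂ}

lemma isOpen_image (hF : IsUnivalent F) {s : Set ℂ} (hs : s ⊆ U) (ho : IsOpen s) :
    IsOpen (F '' s) := by
  have han : AnalyticOnNhd ℂ F U := hF.1.analyticOnNhd isOpen_U
  rcases han.is_constant_or_isOpen (convex_ball (0 : ℂ) 1).isPreconnected with ⟨w, hw⟩ | h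
  · exfalso
    have h2 : (1 / 2 : ℂ) ∈ U := by rw [mem_U_iff]; norm_num
    have := hF.2 zero_mem_U h2 ((hw _ zero_mem_U).trans (hw _ h2).symm)
    norm_num at this
  · exact h s hs ho

/-- The inverse of a univalent function. -/
noncomputable def inv (F : ℂ → ℂ) : ℂ → ℂ := Function.invFunOn F U

lemma inv_mem {u : ℂ} (hu : u ∈ F '' U) : inv F u ∈ U := Function.invFunOn_mem hu

lemma apply_inv {u : ℂ} (hu : u ∈ F '' U) : F (inv F u) = u := Function.invFunOn_eq hu

lemma inv_apply (hF : IsUnivalent F) {z : ℂ} (hz : z ∈ U) : inv F (F z) = z :=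
  hF.2 (inv_mem ⟨z, hz, rfl⟩) hz (apply_inv ⟨z, hz, rfl⟩)

lemma continuousAt_inv (hF : IsUnivalent F) {u : ℂ} (hu : u ∈ F '' U) :
    ContinuousAt (inv F) u := by
  rw [ContinuousAt, tendsto_def]
  intro s hs
  obtain ⟨t, hts, hto, htu⟩ := mem_nhds_iff.1 hs
  have h1 : F '' (t ∩ U) ∈ 𝓝 u :=
    (hF.isOpen_image inter_subset_right (hto.inter isOpen_U)).mem_nhds
      ⟨_, ⟨htu, inv_mem hu⟩, apply_inv hu⟩
  filter_upwards [h1]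
  rintro _ ⟨z, ⟨hz, hzU⟩, rfl⟩
  rw [mem_preimage, hF.inv_apply hzU]
  exact hts hz

lemma hasDerivAt (hF : IsUnivalent F) {z : ℂ} (hz : z ∈ U) : HasDerivAt F (deriv F z) z :=
  (hF.1.differentiableAt (isOpen_U.mem_nhds hz)).hasDerivAt

lemma hasDerivAt_inv_of_ne (hF : IsUnivalent F) {z : ℂ} (hz : z ∈ U) (h : deriv F z ≠ 0) :
    HasDerivAt (inv F) (deriv F z)⁻¹ (F z) := by
  have hu : F z ∈ F '' U := ⟨z, hz, rfl⟩
  refine HasDerivAt.of_local_left_inverse (f := F) (hF.continuousAt_inv hu) ?_ h ?_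
  · rw [hF.inv_apply hz]; exact hF.hasDerivAt hz
  · filter_upwards [(hF.isOpen_image subset_rfl isOpen_U).mem_nhds hu] with y hy
    exact apply_inv hy

lemma eventually_deriv_ne (hF : IsUnivalent F) {z : ℂ} (hz : z ∈ U) :
    ∀ᶠ x in 𝓝[≠] z, deriv F x ≠ 0 := by
  have han : AnalyticOnNhd ℂ (deriv F) U := (hF.1.analyticOnNhd isOpen_U).deriv
  rcases (han z hz).eventually_eq_zero_or_eventually_ne_zero with h | h
  · exfalso
    have h0 : EqOn (deriv F) 0 U :=
      han.eqOn_zero_of_preconnected_of_eventuallyEq_zero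
        (convex_ball (0 : ℂ) 1).isPreconnected hz h
    have h2 : (1 / 2 : ℂ) ∈ U := by rw [mem_U_iff]; norm_num
    have := isOpen_U.is_const_of_deriv_eq_zero (convex_ball (0 : ℂ) 1).isPreconnected hF.1 h0
      zero_mem_U h2
    have := hF.2 zero_mem_U h2 this
    norm_num at this
  · exact h

/-- Critical points of `F` are isolated, so the continuous inverse is differentiable on a punctured
neighbourhood and the singularity is removable. This comes before `deriv_ne_zero`, which follows
from it by the chain rule. -/
lemma differentiableAt_inv (hF : IsUnivalent F) {u : ℂ} (hu : u ∈ F '' U) :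
    DifferentiableAt ℂ (inv F) u := by
  refine (analyticAt_of_differentiable_on_punctured_nhds_of_continuousAt ?_
    (hF.continuousAt_inv hu)).differentiableAt
  have hV : F '' U ∈ 𝓝 u := (hF.isOpen_image subset_rfl isOpen_U).mem_nhds hu
  have h1 : Tendsto (inv F) (𝓝[≠] u) (𝓝[≠] (inv F u)) := by
    refine tendsto_nhdsWithin_iff.2 ⟨(hF.continuousAt_inv hu).mono_left nhdsWithin_le_nhds, ?_⟩
    filter_upwards [mem_nhdsWithin_of_mem_nhds hV, self_mem_nhdsWithin] with y hy hne h
    apply hne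
    rw [mem_singleton_iff, ← apply_inv hy, ← apply_inv hu]
    exact congrArg F h
  filter_upwards [mem_nhdsWithin_of_mem_nhds hV,
    h1.eventually (hF.eventually_deriv_ne (inv_mem hu))] with y hy hne
  have := (hF.hasDerivAt_inv_of_ne (inv_mem hy) hne).differentiableAt
  rwa [apply_inv hy] at this

lemma deriv_ne_zero (hF : IsUnivalent F) {z : ℂ} (hz : z ∈ U) : deriv F z ≠ 0 := by
  intro h
  have h1 := (hF.differentiableAt_inv ⟨z, hz, rfl⟩).hasDerivAt.comp z (hF.hasDerivAt hz)
  have h2 : HasDerivAt (inv F ∘ F) 1 z :=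
    (hasDerivAt_id z).congr_of_eventuallyEq (by
      filter_upwards [isOpen_U.mem_nhds hz] with x hx
      exact hF.inv_apply hx)
  have := h1.unique h2
  simp [h] at this

lemma hasDerivAt_inv (hF : IsUnivalent F) {z : ℂ} (hz : z ∈ U) :
    HasDerivAt (inv F) (deriv F z)⁻¹ (F z) :=
  hF.hasDerivAt_inv_of_ne hz (hF.deriv_ne_zero hz)

lemma differentiableOn_inv_comp (hF : IsUnivalent F) {G : ℂ → ℂ} {s : Set ℂ}
    (hG : DifferentiableOn ℂ G s) (h : MapsTo G s (F '' U)) :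
    DifferentiableOn ℂ (fun z => inv F (G z)) s := fun z hz =>
  (hF.differentiableAt_inv (h hz)).comp_differentiableWithinAt z (hG z hz)

/-- Schwarz's lemma for functions subordinate to a univalent function. -/
lemma norm_inv_le (hF : IsUnivalent F) {G : ℂ → ℂ} (hG : DifferentiableOn ℂ G U)
    (h : MapsTo G U (F '' U)) (h0 : G 0 = F 0) {z : ℂ} (hz : z ∈ U) :
    ‖inv F (G z)‖ ≤ ‖z‖ := by
  refine Complex.norm_le_norm_of_mapsTo_ball (hF.differentiableOn_inv_comp hG h)
    (fun x hx => Metric.ball_subset_closedBall (inv_mem (h hx))) ?_ (mem_U_iff.1 hz)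
  rw [h0, hF.inv_apply zero_mem_U]

lemma subord_of_mapsTo (hF : IsUnivalent F) {G : ℂ → ℂ} (hG : DifferentiableOn ℂ G U)
    (h : MapsTo G U (F '' U)) (h0 : G 0 = F 0) : Subord G F :=
  ⟨fun z => inv F (G z), hF.differentiableOn_inv_comp hG h,
    by simp only [h0, hF.inv_apply zero_mem_U],
    fun z hz => mem_U_iff.1 (inv_mem (h hz)), fun z hz => (apply_inv (h hz)).symm⟩

end IsUnivalent

/-! ### Convex univalent functions: images of discs and the curvature inequality -/

lemma _root_.HasDerivAt.nonpos_of_eventually_le_right {f : ℝ → ℝ} {d a : ℝ}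
    (hf : HasDerivAt f d a) (h : ∀ᶠ s in 𝓝[>] a, f s ≤ f a) : d ≤ 0 := by
  have h1 : Tendsto (slope f a) (𝓝[>] a) (𝓝 d) :=
    hf.tendsto_slope.mono_left (nhdsWithin_mono _ fun x hx => ne_of_gt hx)
  refine le_of_tendsto h1 ?_
  filter_upwards [h, self_mem_nhdsWithin] with s hs hsa
  rw [slope_def_field]
  exact div_nonpos_of_nonpos_of_nonneg (by linarith) (sub_nonneg.2 (le_of_lt hsa))

lemma re_div_eq_re_conj_mul (w z : ℂ) :
    (w / z).re = ((starRingEnd ℂ) z * w).re / normSq z := by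
  rw [Complex.div_re, mul_re, conj_re, conj_im]; ring

lemma re_conj_mul_le (z w : ℂ) (h : ‖w‖ ≤ ‖z‖) :
    ((starRingEnd ℂ) z * w).re ≤ ((starRingEnd ℂ) z * z).re := by
  have h1 : ((starRingEnd ℂ) z * z).re = ‖z‖ * ‖z‖ := by
    rw [← normSq_eq_conj_mul_self, ofReal_re, normSq_eq_norm_sq, sq]
  calc _ ≤ ‖(starRingEnd ℂ) z * w‖ := re_le_norm _
    _ = ‖z‖ * ‖w‖ := by rw [norm_mul, norm_conj]
    _ ≤ ‖z‖ * ‖z‖ := by gcongr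
    _ = _ := h1.symm

namespace IsConvexUnivalent

variable {q : ℂ → ℂ}

/-- The function `x ↦ (1 - s) q x + s q (ζ / z * x)` takes values in the convex set `q(U)` and
equals `q 0` at `0`, so Schwarz's lemma applies to it composed with the inverse of `q`; evaluate at
`x = z`. -/
lemma norm_inv_segment_le (hq : IsConvexUnivalent q) {z ζ : ℂ} (hz : z ∈ U) (hζ : ‖ζ‖ ≤ ‖z‖)
    {s : ℝ} (hs : s ∈ Icc (0 : ℝ) 1) :
    ‖IsUnivalent.inv q (q z + s * (q ζ - q z))‖ ≤ ‖z‖ := by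
  have hq1 := hq.1
  obtain rfl | hz0 := eq_or_ne z 0
  · have : ζ = 0 := by simpa using hζ
    subst this
    simp [hq1.inv_apply zero_mem_U]
  have ha : ‖ζ / z‖ ≤ 1 := by rw [norm_div]; exact div_le_one_of_le₀ hζ (norm_nonneg _)
  have haU : MapsTo (fun x => ζ / z * x) U U := fun x hx => by
    rw [mem_U_iff] at hx ⊢
    rw [norm_mul]
    nlinarith [norm_nonneg x]
  have hG : DifferentiableOn ℂ (fun x => q x + s * (q (ζ / z * x) - q x)) U := by
    have : DifferentiableOn ℂ (fun x => q (ζ / z * x)) U :=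
      hq1.1.comp (by fun_prop) haU
    exact hq1.1.add ((this.sub hq1.1).const_mul _)
  have hm : MapsTo (fun x => q x + s * (q (ζ / z * x) - q x)) U (q '' U) := fun x hx => by
    have := hq.2 (mem_image_of_mem q hx) (mem_image_of_mem q (haU hx))
      (sub_nonneg.2 hs.2) hs.1 (by ring)
    convert this using 1
    simp only [real_smul]
    push_cast
    ring
  have := hq1.norm_inv_le hG hm (by simp) hz
  rwa [div_mul_cancel₀ _ hz0] at this

/-- A chord leaving `q z` towards `q ζ` pulls back to a curve starting at `z` and staying in the
disc of radius `‖z‖`, so its initial velocity has no outward component. Thus `z q'(z)` is an outer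
normal of a supporting line at `q z`. -/
lemma re_sub_div_nonpos (hq : IsConvexUnivalent q) {z ζ : ℂ} (hz : z ∈ U) (hζ : ‖ζ‖ ≤ ‖z‖) :
    ((q ζ - q z) / deriv q z / z).re ≤ 0 := by
  have hq1 := hq.1
  set D := q ζ - q z
  have h1 : HasDerivAt (fun s : ℂ => (starRingEnd ℂ) z * IsUnivalent.inv q (q z + s * D))
      ((starRingEnd ℂ) z * (D / deriv q z)) ((0 : ℝ) : ℂ) := by
    have h2 : HasDerivAt (fun s : ℂ => q z + s * D) D ((0 : ℝ) : ℂ) := by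
      simpa using ((hasDerivAt_id ((0 : ℝ) : ℂ)).mul_const D).const_add (q z)
    have h3 : HasDerivAt (IsUnivalent.inv q) (deriv q z)⁻¹ (q z + ((0 : ℝ) : ℂ) * D) := by
      simpa using hq1.hasDerivAt_inv hz
    have h4 := (HasDerivAt.comp (h := fun s : ℂ => q z + s * D) _ h3 h2).const_mul ((starRingEnd ℂ) z)
    rwa [inv_mul_eq_div] at h4
  have h5 := h1.real_of_complex.nonpos_of_eventually_le_right (by
    filter_upwards [Icc_mem_nhdsGT (zero_lt_one' ℝ)] with s hs
    simp only [ofReal_zero, zero_mul, add_zero, hq1.inv_apply hz]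
    exact re_conj_mul_le _ _ (hq.norm_inv_segment_le hz hζ hs))
  rw [re_div_eq_re_conj_mul]
  exact div_nonpos_of_nonpos_of_nonneg h5 (normSq_nonneg _)

/-- The analytic characterization of convexity. -/
lemma re_nonneg (hq : IsConvexUnivalent q) {z : ℂ} (hz : z ∈ U) :
    0 ≤ (1 + z * deriv (deriv q) z / deriv q z).re := by
  have hq1 := hq.1
  obtain rfl | hz0 := eq_or_ne z 0
  · simp
  have hd0 := hq1.deriv_ne_zero hz
  by_contra! hneg
  have hmem : ∀ s : ℝ, z * exp (s * I) ∈ U := fun s => by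
    rw [mem_U_iff, norm_mul, norm_exp_ofReal_mul_I, mul_one]; exact mem_U_iff.1 hz
  have hexp : ∀ s : ℂ, HasDerivAt (fun s : ℂ => z * exp (s * I)) (z * exp (s * I) * I) s := by
    intro s
    have h1 := ((hasDerivAt_id s).mul_const I).cexp.const_mul z
    simpa [mul_assoc] using h1
  -- `R` is the height, in the direction `z q'(z)`, of the image of the circle through `z`. The
  -- supporting line makes it maximal at `s = 0`, where its second derivative is `-Re (1 + z q'' /
  -- q')`.
  set R : ℝ → ℝ := fun s => (q (z * exp (s * I)) / deriv q z / z).re with hR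
  have hR1 : ∀ s : ℝ, HasDerivAt R
      ((exp (s * I) * I * deriv q (z * exp (s * I)) / deriv q z).re) s := by
    intro s
    have h1 := (((hq1.hasDerivAt (hmem s)).comp (s : ℂ) (hexp s)).div_const
      (deriv q z)).div_const z
    convert! h1.real_of_complex using 2
    field_simp
  have hR1' : deriv R = fun s : ℝ =>
      (exp (s * I) * I * deriv q (z * exp (s * I)) / deriv q z).re :=
    funext fun s => (hR1 s).deriv
  have hq2 : HasDerivAt (deriv q) (deriv (deriv q) z) z :=
    (((hq1.1.analyticOnNhd isOpen_U).deriv z hz).differentiableAt).hasDerivAt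
  have hR2 : HasDerivAt (deriv R) (-(1 + z * deriv (deriv q) z / deriv q z)).re 0 := by
    rw [hR1']
    have e0 : HasDerivAt (fun s : ℂ => exp (s * I)) I ((0 : ℝ) : ℂ) := by
      simpa using ((hasDerivAt_id ((0 : ℝ) : ℂ)).mul_const I).cexp
    have e1 : HasDerivAt (fun s : ℂ => z * exp (s * I)) (z * I) ((0 : ℝ) : ℂ) := e0.const_mul z
    have e2 : HasDerivAt (deriv q) (deriv (deriv q) z) (z * exp (((0 : ℝ) : ℂ) * I)) := by
      simpa using hq2
    have h1 := ((e0.mul_const I).mul (HasDerivAt.comp (h := fun s : ℂ => z * exp (s * I)) _ e2 e1)).div_const (deriv q z)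
    convert! h1.real_of_complex using 2
    simp only [ofReal_zero, zero_mul, exp_zero, mul_one, one_mul, Function.comp]
    field_simp
    linear_combination (-deriv q z - z * deriv (deriv q) z) * I_sq
  have hmax : ∀ s, R s ≤ R 0 := fun s => by
    have h1 := hq.re_sub_div_nonpos (z := z) (ζ := z * exp (s * I)) hz
      (by rw [norm_mul, norm_exp_ofReal_mul_I, mul_one])
    rw [sub_div, sub_div, sub_re] at h1
    simpa [hR] using h1
  have hpos : 0 < deriv (deriv R) 0 := by
    rw [hR2.deriv, neg_re]; linarith
  -- A positive second derivative would make the maximum at `0` also a local minimum, so `R` would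
  -- be locally constant and its second derivative zero.
  have hmin : IsLocalMin R 0 := isLocalMin_of_deriv_deriv_pos hpos
    (by rw [hR1']; simp [hd0]) (hR1 0).continuousAt
  have hconst : R =ᶠ[𝓝 0] fun _ => R 0 := hmin.mono fun s hs => le_antisymm (hmax s) hs
  have := hconst.deriv.deriv_eq
  simp only [deriv_const', deriv_const] at this
  exact hpos.ne' this

end IsConvexUnivalent

/-! ### The family `m q + t c z q'` -/

lemma _root_.HasDerivAt.eventually_lt_right {f : ℝ → ℝ} {d a : ℝ}
    (hf : HasDerivAt f d a) (hd : d < 0) : ∀ᶠ s in 𝓝[>] a, f s < f a := by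
  have h1 : Tendsto (slope f a) (𝓝[>] a) (𝓝 d) :=
    hf.tendsto_slope.mono_left (nhdsWithin_mono _ fun x hx => ne_of_gt hx)
  filter_upwards [h1.eventually (gt_mem_nhds hd), self_mem_nhdsWithin] with s hs hsa
  rw [slope_def_field, div_neg_iff] at hs
  have : a < s := hsa
  rcases hs with h | h <;> linarith [h.1, h.2]

namespace IsConvexUnivalent

variable {q : ℂ → ℂ} {m c : ℂ}

lemma re_add_mul_pos (hq : IsConvexUnivalent q) (hmc : 0 < (m / c).re) {z : ℂ} (hz : z ∈ U)
    {t : ℝ} (ht : 0 ≤ t) : 0 < (m / c + t * (1 + z * deriv (deriv q) z / deriv q z)).re := by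
  rw [add_re, re_ofReal_mul]
  have := mul_nonneg ht (hq.re_nonneg hz)
  linarith

lemma hasDerivAt_deriv (hq : IsConvexUnivalent q) {z : ℂ} (hz : z ∈ U) :
    HasDerivAt (deriv q) (deriv (deriv q) z) z :=
  (((hq.1.1.analyticOnNhd isOpen_U).deriv z hz).differentiableAt).hasDerivAt

/-- Solving the equation for the parameter gives `s = τ x` with `τ'(z) = -A / z`, where `A = m / c +
t (1 + z q'' / q')`. The local inverse of `τ` thus moves with velocity `-z / A`, which points
inwards because `Re A > 0`. -/
lemma eventually_exists_norm_le (hq : IsConvexUnivalent q) (hmc : 0 < (m / c).re)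
    {z : ℂ} (hz : z ∈ U) (hz0 : z ≠ 0) {t : ℝ} (ht : 0 ≤ t) :
    ∀ᶠ s : ℝ in 𝓝[>] t, ∃ x, ‖x‖ ≤ ‖z‖ ∧
      m * q x + s * (c * (x * deriv q x)) = m * q z + t * (c * (z * deriv q z)) := by
  have hq1 := hq.1
  have hc : c ≠ 0 := by rintro rfl; simp at hmc
  have hd0 := hq1.deriv_ne_zero hz
  set v := m * q z + t * (c * (z * deriv q z)) with hv
  set A := m / c + t * (1 + z * deriv (deriv q) z / deriv q z) with hA
  have hApos : 0 < A.re := hq.re_add_mul_pos hmc hz ht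
  have hA0 : A ≠ 0 := by intro h; simp [h] at hApos
  set τ : ℂ → ℂ := fun x => (v - m * q x) / (c * (x * deriv q x)) with hτ
  have hden : c * (z * deriv q z) ≠ 0 := mul_ne_zero hc (mul_ne_zero hz0 hd0)
  have hτz : τ z = t := by simp only [hτ, hv]; field_simp; ring
  have hqa : AnalyticAt ℂ q z := hq1.1.analyticOnNhd isOpen_U z hz
  have hτa : AnalyticAt ℂ τ z :=
    (analyticAt_const.sub (analyticAt_const.mul hqa)).div
      (analyticAt_const.mul (analyticAt_id.mul hqa.deriv)) hden
  have hτd : HasDerivAt τ (-A / z) z := by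
    have h1 := (((hq1.hasDerivAt hz).const_mul m).const_sub v).div
      (((hasDerivAt_id' z).fun_mul (hq.hasDerivAt_deriv hz)).const_mul c) hden
    convert! h1 using 1
    simp only [hv, hA]
    field_simp
    ring
  have hD0 : -A / z ≠ 0 := div_ne_zero (neg_ne_zero.2 hA0) hz0
  have hst : HasStrictDerivAt τ (-A / z) z := hτd.deriv ▸ hτa.hasStrictDerivAt
  set σ : ℂ → ℂ := hst.localInverse τ (-A / z) z hD0 with hσ
  have hσd : HasDerivAt σ (-A / z)⁻¹ (t : ℂ) := by
    rw [← hτz]; exact (hst.to_localInverse hD0).hasDerivAt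
  have hσt : σ t = z := by
    rw [← hτz]; exact (hst.eventually_left_inverse hD0).self_of_nhds
  have hσr : HasDerivAt (fun s : ℝ => σ s) (-A / z)⁻¹ t := hσd.comp_ofReal
  have hnorm : ∀ᶠ s : ℝ in 𝓝[>] t, ‖σ s‖ ^ 2 < ‖σ t‖ ^ 2 := by
    refine hσr.norm_sq.eventually_lt_right ?_
    rw [hσt, Complex.inner]
    have : (-A / z)⁻¹ * (starRingEnd ℂ) z = -((normSq z : ℂ) * A⁻¹) := by
      rw [normSq_eq_conj_mul_self]; field_simp
    rw [this, neg_re, re_ofReal_mul, inv_re]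
    have h1 : 0 < normSq z := normSq_pos.2 hz0
    have h2 : 0 < normSq A := normSq_pos.2 hA0
    have : 0 < normSq z * (A.re / normSq A) := by positivity
    linarith
  have hright : ∀ᶠ s : ℝ in 𝓝 t, τ (σ s) = s := by
    have := hst.eventually_right_inverse hD0
    rw [hτz] at this
    exact (continuous_ofReal.tendsto t).eventually this
  have hgood : ∀ᶠ s : ℝ in 𝓝 t, c * (σ s * deriv q (σ s)) ≠ 0 := by
    have h1 : ContinuousAt (fun x => c * (x * deriv q x)) z :=
      (analyticAt_const.mul (analyticAt_id.mul hqa.deriv)).continuousAt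
    have h2 : Tendsto (fun s : ℝ => σ s) (𝓝 t) (𝓝 z) := by
      have := hσr.continuousAt.tendsto
      rwa [hσt] at this
    exact h2.eventually (h1.eventually_ne hden)
  filter_upwards [hnorm, nhdsWithin_le_nhds hright, nhdsWithin_le_nhds hgood] with s h1 h2 h3
  rw [hσt] at h1
  refine ⟨σ s, (pow_lt_pow_iff_left₀ (norm_nonneg _) (norm_nonneg _) two_ne_zero).1 h1 |>.le, ?_⟩
  have h4 : v - m * q (σ s) = s * (c * (σ s * deriv q (σ s))) := (div_eq_iff h3).1 h2
  rw [← h4]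
  ring

/-- `m q + t c z q'`, for `0 ≤ t ≤ 1`, is subordinate to `m q + c z q'`. -/
lemma exists_norm_le_of_le_one (hq : IsConvexUnivalent q) (hmc : 0 < (m / c).re)
    {z : ℂ} (hz : z ∈ U) {t : ℝ} (ht : t ∈ Icc (0 : ℝ) 1) :
    ∃ x, ‖x‖ ≤ ‖z‖ ∧
      m * q x + c * (x * deriv q x) = m * q z + t * (c * (z * deriv q z)) := by
  set v := m * q z + t * (c * (z * deriv q z)) with hv
  set L : ℂ × ℝ → ℂ := fun y => m * q y.1 + y.2 * (c * (y.1 * deriv q y.1)) with hL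
  set T : Set ℝ := {s | ∃ x, ‖x‖ ≤ ‖z‖ ∧ L (x, s) = v} with hT
  have hballU : ∀ x, ‖x‖ ≤ ‖z‖ → x ∈ U := fun x hx =>
    mem_U_iff.2 (hx.trans_lt (mem_U_iff.1 hz))
  have hclosed : IsClosed (T ∩ Icc t 1) := by
    set K := Metric.closedBall (0 : ℂ) ‖z‖ ×ˢ Icc t 1 with hK
    have hKc : IsCompact K := (isCompact_closedBall _ _).prod isCompact_Icc
    have hLc : ContinuousOn L K := by
      have hfst : MapsTo Prod.fst K U := fun y hy => hballU _ (by simpa using hy.1)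
      have h1 : ContinuousOn (fun y : ℂ × ℝ => q y.1) K :=
        hq.1.1.continuousOn.comp continuousOn_fst hfst
      have h2 : ContinuousOn (fun y : ℂ × ℝ => deriv q y.1) K :=
        ((hq.1.1.analyticOnNhd isOpen_U).deriv.continuousOn).comp continuousOn_fst hfst
      have h3 : Continuous (fun y : ℂ × ℝ => (y.2 : ℂ)) := by fun_prop
      exact (continuousOn_const.mul h1).add
        (h3.continuousOn.mul (continuousOn_const.mul (continuousOn_fst.mul h2)))
    have h4 : IsCompact (K ∩ L ⁻¹' {v}) :=
      hKc.of_isClosed_subset (hLc.preimage_isClosed_of_isClosed hKc.isClosed isClosed_singleton)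
        inter_subset_left
    convert (h4.image continuous_snd).isClosed using 1
    ext s
    simp only [hT, hK, mem_inter_iff, mem_ofPred_eq, mem_image, mem_prod, mem_preimage,
      mem_singleton_iff, Metric.mem_closedBall, dist_zero_right, Prod.exists]
    constructor
    · rintro ⟨⟨x, hx, hxv⟩, hs⟩
      exact ⟨x, s, ⟨⟨hx, hs⟩, hxv⟩, rfl⟩
    · rintro ⟨x, s, ⟨⟨hx, hs⟩, hxv⟩, rfl⟩
      exact ⟨⟨x, hx, hxv⟩, hs⟩
  -- Continuation in the parameter from `t` to `1`: `T` is closed there by compactness of the disc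
  -- and extends to the right by the inward motion.
  have hsub : Icc t 1 ⊆ T := by
    refine hclosed.Icc_subset_of_forall_mem_nhdsWithin ⟨z, le_rfl, rfl⟩ ?_
    rintro s ⟨⟨x, hx, hxv⟩, hs⟩
    obtain rfl | hx0 := eq_or_ne x 0
    -- At the centre the term `c x q'(x)` vanishes, so `0` solves the equation for every parameter.
    · refine univ_mem' fun s' => ⟨0, hx, ?_⟩
      rw [← hxv]; simp [hL]
    · filter_upwards [hq.eventually_exists_norm_le hmc (hballU x hx) hx0 (ht.1.trans hs.1)]
        with s' ⟨x', hx', h⟩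
      exact ⟨x', hx'.trans hx, h.trans hxv⟩
  obtain ⟨x, hx, hxv⟩ := hsub ⟨ht.2, le_rfl⟩
  exact ⟨x, hx, by simpa [hL] using hxv⟩

/-- `m q + c z q'` is univalent. -/
lemma isUnivalent_add (hq : IsConvexUnivalent q) (hmc : 0 < (m / c).re) :
    IsUnivalent (fun z => m * q z + c * (z * deriv q z)) := by
  have hq1 := hq.1
  have hc : c ≠ 0 := by rintro rfl; simp at hmc
  have hder : ∀ z ∈ U, HasDerivAt (fun z => m * q z + c * (z * deriv q z))
      (m * deriv q z + c * (deriv q z + z * deriv (deriv q) z)) z := fun z hz => by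
    simpa using ((hq1.hasDerivAt hz).const_mul m).fun_add
      (((hasDerivAt_id' z).fun_mul (hq.hasDerivAt_deriv hz)).const_mul c)
  refine ⟨fun z hz => (hder z hz).differentiableAt.differentiableWithinAt, ?_⟩
  intro x hx y hy hxy
  by_contra hne
  set d := q y - q x with hd
  have hd0 : d ≠ 0 := sub_ne_zero.2 fun h => hne (hq1.2 hx hy h.symm)
  have hmem : ∀ s ∈ Icc (0 : ℝ) 1, q x + s * d ∈ q '' U := fun s hs => by
    have := hq.2 (mem_image_of_mem q hx) (mem_image_of_mem q hy)
      (sub_nonneg.2 hs.2) hs.1 (by ring)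
    convert this using 1
    simp only [real_smul, hd]
    push_cast
    ring
  -- Noshiro–Warschawski on the convex domain `q(U)`: along the segment from `q x` to `q y`, the
  -- real part of `(m q + c z q') ∘ q⁻¹` divided by `d c` has positive derivative, against Rolle.
  set g : ℝ → ℝ := fun s => (m * q (IsUnivalent.inv q (q x + s * d)) +
    c * (IsUnivalent.inv q (q x + s * d) * deriv q (IsUnivalent.inv q (q x + s * d))) |>
      fun w => w / d / c).re with hg
  have hgd : ∀ s ∈ Icc (0 : ℝ) 1, HasDerivAt g (m / c + ((1 : ℝ) : ℂ) *
      (1 + IsUnivalent.inv q (q x + s * d) * deriv (deriv q) (IsUnivalent.inv q (q x + s * d)) /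
        deriv q (IsUnivalent.inv q (q x + s * d)))).re s := fun s hs => by
    have hw := hmem s hs
    set w := IsUnivalent.inv q (q x + s * d) with hwdef
    have hwU : w ∈ U := IsUnivalent.inv_mem hw
    have hd0' := hq1.deriv_ne_zero hwU
    have h1 : HasDerivAt (fun s : ℂ => q x + s * d) d (s : ℂ) := by
      simpa using ((hasDerivAt_id (s : ℂ)).mul_const d).const_add (q x)
    have h2 : HasDerivAt (IsUnivalent.inv q) (deriv q w)⁻¹ (q x + s * d) := by
      have := hq1.hasDerivAt_inv hwU
      rwa [hwdef, IsUnivalent.apply_inv hw] at this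
    have h3 := HasDerivAt.comp (h := fun s : ℂ => q x + s * d) _ h2 h1
    have h4 := ((HasDerivAt.comp (s : ℂ) (hder w hwU) h3).div_const d).div_const c
    convert! h4.real_of_complex using 2
    push_cast
    field_simp
  obtain ⟨s, hs, hs'⟩ := exists_deriv_eq_zero (f := g) zero_lt_one
    (fun s hs => (hgd s hs).continuousAt.continuousWithinAt) (by
      simp only [hg, ofReal_zero, zero_mul, add_zero, ofReal_one, one_mul, hd,
        add_sub_cancel, hq1.inv_apply hx, hq1.inv_apply hy]
      rw [show m * q x + c * (x * deriv q x) = m * q y + c * (y * deriv q y) from hxy])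
  have hs2 := Ioo_subset_Icc_self hs
  rw [(hgd s hs2).deriv] at hs'
  exact (hq.re_add_mul_pos hmc (IsUnivalent.inv_mem (hmem s hs2)) zero_le_one).ne' hs'

end IsConvexUnivalent

/-! ### Jack's lemma and the comparison of `q` with `w` -/

/-- Jack's lemma. -/
lemma exists_one_le_mul_deriv_eq {φ : ℂ → ℂ} {z d : ℂ}
    (hφ : DifferentiableOn ℂ φ (Metric.ball 0 ‖z‖)) (hd : HasDerivAt φ d z) (h0 : φ 0 = 0)
    (hz : z ≠ 0) (hφz : φ z ≠ 0) (hmax : ∀ x, ‖x‖ ≤ ‖z‖ → ‖φ x‖ ≤ ‖φ z‖) :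
    ∃ k : ℝ, 1 ≤ k ∧ z * d = k * φ z := by
  set ζ := φ z with hζ
  have hconj : ((starRingEnd ℂ) ζ * ζ).re = normSq ζ := by
    rw [← normSq_eq_conj_mul_self, ofReal_re]
  have hpos : 0 < normSq ζ := normSq_pos.2 hφz
  set B := (starRingEnd ℂ) ζ * (z * d) with hB
  have hzpos : 0 < ‖z‖ := norm_pos_iff.2 hz
  -- Tangential direction: rotating `z` keeps the modulus, so `Re (conj ζ * φ)` is maximal at `z`
  -- along the circle.
  have him : B.im = 0 := by
    have h1 : HasDerivAt (fun s : ℂ => z * exp (s * I)) (z * I) ((0 : ℝ) : ℂ) := by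
      simpa using ((hasDerivAt_id ((0 : ℝ) : ℂ)).mul_const I).cexp.const_mul z
    have h2 : HasDerivAt φ d (z * exp (((0 : ℝ) : ℂ) * I)) := by simpa using hd
    have h3 := ((HasDerivAt.comp (h := fun s : ℂ => z * exp (s * I)) _ h2 h1).const_mul
      ((starRingEnd ℂ) ζ)).real_of_complex
    have h4 := IsLocalMax.hasDerivAt_eq_zero (Eventually.of_forall fun s => ?_) h3
    · have : (starRingEnd ℂ) ζ * (d * (z * I)) = B * I := by rw [hB]; ring
      rw [this, mul_I_re] at h4
      linarith
    · simp only [Function.comp, ofReal_zero, zero_mul, exp_zero, mul_one]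
      refine re_conj_mul_le _ _ (hmax _ ?_)
      rw [norm_mul, norm_exp_ofReal_mul_I, mul_one]
  -- Radial direction: Schwarz's lemma gives `‖φ ((1 - s) z)‖ ≤ (1 - s) ‖ζ‖`, with equality at `s =
  -- 0`; compare derivatives there.
  have hre : normSq ζ ≤ B.re := by
    have h1 : HasDerivAt (fun s : ℂ => (1 - s) * z) (-z) ((0 : ℝ) : ℂ) := by
      simpa using ((hasDerivAt_id ((0 : ℝ) : ℂ)).const_sub 1).mul_const z
    have h2 : HasDerivAt φ d ((1 - ((0 : ℝ) : ℂ)) * z) := by simpa using hd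
    have h3 := ((HasDerivAt.comp (h := fun s : ℂ => (1 - s) * z) _ h2 h1).const_mul
      ((starRingEnd ℂ) ζ)).real_of_complex
    have h4 := (h3.fun_add ((hasDerivAt_id' (0 : ℝ)).mul_const
      (normSq ζ))).nonpos_of_eventually_le_right (by
        filter_upwards [Ioc_mem_nhdsGT (zero_lt_one' ℝ)] with s hs
        simp only [Function.comp, ofReal_zero, sub_zero, one_mul, zero_mul, add_zero]
        have hn : ‖(1 - (s : ℂ)) * z‖ = (1 - s) * ‖z‖ := by
          rw [norm_mul, ← ofReal_one, ← ofReal_sub, norm_real, Real.norm_eq_abs,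
            abs_of_nonneg (by linarith [hs.2])]
        have h5 : ‖φ ((1 - s) * z)‖ ≤ (1 - s) * ‖ζ‖ := by
          have := Complex.dist_le_div_mul_dist_of_mapsTo_ball (f := φ) (c := 0) (R₁ := ‖z‖)
            (R₂ := ‖ζ‖) (z := (1 - s) * z) hφ (fun x hx => by
              rw [h0, mem_closedBall_zero_iff]
              exact hmax x (mem_ball_zero_iff.1 hx).le) (by
              rw [mem_ball_zero_iff, hn]; nlinarith [hs.1])
          rw [h0, dist_zero_right, dist_zero_right, hn] at this
          refine this.trans_eq ?_
          field_simp
        have h6 : ((starRingEnd ℂ) ζ * φ ((1 - s) * z)).re ≤ (1 - s) * normSq ζ := by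
          refine (re_le_norm _).trans ?_
          rw [norm_mul, norm_conj, normSq_eq_norm_sq]
          nlinarith [norm_nonneg ζ]
        rw [← hζ, hconj]
        linarith)
    have : (starRingEnd ℂ) ζ * (d * -z) = -B := by rw [hB]; ring
    rw [this, neg_re] at h4
    linarith
  refine ⟨B.re / normSq ζ, (one_le_div hpos).2 hre, ?_⟩
  have hBre : B = (B.re : ℂ) := by apply Complex.ext <;> simp [him]
  have hc0 : (starRingEnd ℂ) ζ ≠ 0 := by simpa using hφz
  apply mul_left_cancel₀ hc0
  rw [ofReal_div, ← hBre, ← hB, normSq_eq_conj_mul_self]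
  field_simp

namespace IsConvexUnivalent

variable {q w : ℂ → ℂ} {m c : ℂ}

/-- If `q (B_r)` touches the boundary of `w (B_R)` from inside, then `R ≤ r`. -/
lemma norm_le_of_touching (hq : IsConvexUnivalent q) (hmc : 0 < (m / c).re)
    (hw : IsUnivalent w) (hW : IsUnivalent (fun z => m * w z + c * (z * deriv w z)))
    (hsub : Subord (fun z => m * q z + c * (z * deriv q z))
      (fun z => m * w z + c * (z * deriv w z))) (h0 : q 0 = w 0) {z ζ : ℂ} (hz : z ∈ U)
    (hζ : ζ ∈ U) (hz0 : z ≠ 0) (hζ0 : ζ ≠ 0) (hzζ : q z = w ζ)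
    (hin : ∀ x, ‖x‖ ≤ ‖z‖ → q x ∈ w '' Metric.closedBall 0 ‖ζ‖) : ‖ζ‖ ≤ ‖z‖ := by
  obtain ⟨ω, hω, hω0, hω1, hωeq⟩ := hsub
  set φ : ℂ → ℂ := fun x => IsUnivalent.inv w (q x) with hφ
  have hφz : φ z = ζ := by simp only [hφ, hzζ, hw.inv_apply hζ]
  have hball : ∀ x, ‖x‖ ≤ ‖ζ‖ → x ∈ U := fun x hx =>
    mem_U_iff.2 (hx.trans_lt (mem_U_iff.1 hζ))
  have hd : HasDerivAt φ ((deriv w ζ)⁻¹ * deriv q z) z := by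
    refine HasDerivAt.comp z ?_ (hq.1.hasDerivAt hz)
    rw [hzζ]
    exact hw.hasDerivAt_inv hζ
  obtain ⟨k, hk, hkeq⟩ := exists_one_le_mul_deriv_eq (φ := φ) (z := z)
    (hw.differentiableOn_inv_comp
      (hq.1.1.mono (Metric.ball_subset_ball (mem_U_iff.1 hz).le)) (fun x hx => by
        obtain ⟨y, hy, hyx⟩ := hin x (mem_ball_zero_iff.1 hx).le
        exact ⟨y, hball y (mem_closedBall_zero_iff.1 hy), hyx⟩)) hd
    (by simp only [hφ, h0, hw.inv_apply zero_mem_U]) hz0 (by rwa [hφz]) (fun x hx => by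
      obtain ⟨y, hy, hyx⟩ := hin x hx
      have hy' := mem_closedBall_zero_iff.1 hy
      simp only [hφz]
      simp only [hφ, ← hyx, hw.inv_apply (hball y hy')]
      exact hy')
  rw [hφz] at hkeq
  have hwd := hw.deriv_ne_zero hζ
  have hk0 : (k : ℂ) ≠ 0 := by
    have : k ≠ 0 := by linarith
    exact_mod_cast this
  -- The parameter `k⁻¹` cancels the factor in `z q'(z) = k ζ w'(ζ)`, so the value reached is
  -- exactly `m w ζ + c ζ w'(ζ)`.
  obtain ⟨x, hx, hxeq⟩ := hq.exists_norm_le_of_le_one hmc hz (t := k⁻¹)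
    ⟨by positivity, inv_le_one_of_one_le₀ hk⟩
  have hxU : x ∈ U := mem_U_iff.2 (hx.trans_lt (mem_U_iff.1 hz))
  have hWeq : m * w ζ + c * (ζ * deriv w ζ) = m * w (ω x) + c * (ω x * deriv w (ω x)) := by
    refine Eq.trans ?_ (hωeq x hxU)
    beta_reduce
    rw [hxeq, hzζ]
    have : z * deriv q z = k * ζ * deriv w ζ := by rw [← hkeq]; field_simp
    rw [this]
    push_cast
    field_simp
  have := hW.2 hζ (mem_U_iff.2 (hω1 x hxU)) hWeq
  rw [this]
  exact (Complex.norm_le_norm_of_mapsTo_ball hω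
    (fun y hy => mem_closedBall_zero_iff.2 (hω1 y hy).le) hω0 (mem_U_iff.1 hxU)).trans hx

lemma mapsTo_image_ball (hq : IsConvexUnivalent q) (hmc : 0 < (m / c).re)
    (hw : IsUnivalent w) (hW : IsUnivalent (fun z => m * w z + c * (z * deriv w z)))
    (hsub : Subord (fun z => m * q z + c * (z * deriv q z))
      (fun z => m * w z + c * (z * deriv w z))) (h0 : q 0 = w 0) {R : ℝ} (hR : 0 < R)
    (hR1 : R < 1) : MapsTo q (Metric.ball 0 R) (w '' Metric.ball 0 R) := by
  have hcU : Metric.closedBall (0 : ℂ) R ⊆ U := Metric.closedBall_subset_ball hR1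
  have hbU : Metric.ball (0 : ℂ) R ⊆ U := Metric.ball_subset_closedBall.trans hcU
  have hO : IsOpen (w '' Metric.ball 0 R) := hw.isOpen_image hbU Metric.isOpen_ball
  have hK : IsClosed (w '' Metric.closedBall 0 R) :=
    ((isCompact_closedBall _ _).image_of_continuousOn (hw.1.continuousOn.mono hcU)).isClosed
  set C := Metric.closedBall (0 : ℂ) R ∩ q ⁻¹' (w '' Metric.ball 0 R)ᶜ with hC
  have hCc : IsCompact C := (isCompact_closedBall _ _).of_isClosed_subset
    ((hq.1.1.continuousOn.mono hcU).preimage_isClosed_of_isClosed Metric.isClosed_closedBall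
      hO.isClosed_compl) inter_subset_left
  rcases C.eq_empty_or_nonempty with hCe | hCn
  · intro x hx
    by_contra hcon
    have : x ∈ C := ⟨Metric.ball_subset_closedBall hx, hcon⟩
    rw [hCe] at this
    exact this
  -- A point of least modulus among those not sent into `w(B_R)`: the disc of radius `‖z‖` is the
  -- first whose image touches the boundary. The touching lemma forces `‖z‖ = R`, so the open disc
  -- contains no such point.
  · obtain ⟨z, ⟨hzR, hzC⟩, hmin⟩ := hCc.exists_isMinOn hCn continuous_norm.continuousOn
    have hzR' := mem_closedBall_zero_iff.1 hzR
    have hlt : ∀ x, ‖x‖ < ‖z‖ → q x ∈ w '' Metric.ball 0 R := fun x hx => by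
      by_contra hcon
      exact hx.not_ge (hmin (show x ∈ C from
        ⟨mem_closedBall_zero_iff.2 (hx.le.trans hzR'), hcon⟩))
    have hz0 : z ≠ 0 := by
      rintro rfl
      exact hzC ⟨0, Metric.mem_ball_self hR, h0.symm⟩
    have hle : ∀ x, ‖x‖ ≤ ‖z‖ → q x ∈ w '' Metric.closedBall 0 R := fun x hx => by
      have h1 : MapsTo q (Metric.ball 0 ‖z‖) (w '' Metric.closedBall 0 R) := fun y hy =>
        image_mono Metric.ball_subset_closedBall (hlt y (mem_ball_zero_iff.1 hy))
      have h2 := h1.closure_of_continuousOn (by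
        rw [closure_ball _ (norm_ne_zero_iff.2 hz0)]
        exact hq.1.1.continuousOn.mono ((Metric.closedBall_subset_closedBall hzR').trans hcU))
      rw [closure_ball _ (norm_ne_zero_iff.2 hz0), hK.closure_eq] at h2
      exact h2 (mem_closedBall_zero_iff.2 hx)
    obtain ⟨ζ, hζ, hζz⟩ := hle z le_rfl
    have hζR : ‖ζ‖ = R := by
      refine (mem_closedBall_zero_iff.1 hζ).antisymm (le_of_not_gt fun h => ?_)
      exact hzC ⟨ζ, mem_ball_zero_iff.2 h, hζz⟩
    have hRz : R ≤ ‖z‖ := by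
      rw [← hζR]
      refine hq.norm_le_of_touching hmc hw hW hsub h0 (hcU hzR) (hcU hζ) hz0 ?_ hζz.symm ?_
      · rw [← norm_pos_iff, hζR]; exact hR
      · rwa [hζR]
    exact fun x hx => hlt x ((mem_ball_zero_iff.1 hx).trans_le hRz)

theorem subord_of_subord_add (hq : IsConvexUnivalent q) (hmc : 0 < (m / c).re)
    (hw : IsUnivalent w) (hW : IsUnivalent (fun z => m * w z + c * (z * deriv w z)))
    (hsub : Subord (fun z => m * q z + c * (z * deriv q z))
      (fun z => m * w z + c * (z * deriv w z))) : Subord q w := by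
  -- At the origin the subordination reads `m q 0 = m w 0`, and `m ≠ 0` since `Re (m / c) > 0`.
  have h0 : q 0 = w 0 := by
    obtain ⟨ω, -, hω0, -, hωeq⟩ := hsub
    have hm : m ≠ 0 := by rintro rfl; simp at hmc
    simpa [hω0, hm] using hωeq 0 zero_mem_U
  refine hw.subord_of_mapsTo hq.1.1 (fun x hx => ?_) h0
  obtain ⟨R, hxR, hR1⟩ := exists_between (mem_U_iff.1 hx)
  exact image_mono (Metric.ball_subset_ball hR1.le)
    (hq.mapsTo_image_ball hmc hw hW hsub h0 ((norm_nonneg x).trans_lt hxR) hR1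
      (mem_ball_zero_iff.2 hxR))

lemma isBestSubordinant (hq : IsConvexUnivalent q) (hmc : 0 < (m / c).re) :
    IsBestSubordinant (fun r s _ _ => m * r + c * s)
      (fun z => m * q z + c * (z * deriv q z)) q := by
  refine ⟨hq.1, ⟨hq.1.1, fun w hw => hq.subord_of_subord_add hmc hw.1 hw.2.1 hw.2.2⟩,
    fun r hr => hr.2 q ⟨hq.1, hq.isUnivalent_add hmc, ?_⟩⟩
  exact ⟨id, differentiableOn_id, rfl, fun z hz => mem_U_iff.1 hz, fun z _ => rfl⟩

end IsConvexUnivalent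

/-! ### The operators `P^s` and the first-order form of `Φ` -/

section Operator

variable {f : ℂ → ℂ} {β : ℂ}

lemma tendsto_norm_div_succ (β : ℂ) (hβ : β ≠ 0) (hβk : ∀ k : ℕ, (k : ℂ) + β + 1 ≠ 0) :
    Tendsto (fun k : ℕ => ‖β / ((k + 1 : ℕ) + β + 1)‖ / ‖β / (k + β + 1)‖) atTop (𝓝 1) := by
  have h1 : Tendsto (fun k : ℕ => (((k + 1 : ℕ) : ℂ) + β + 1)⁻¹) atTop (𝓝 0) := by
    have h2 : Tendsto (fun k : ℕ => ((k + 1 : ℕ) : ℂ)) atTop (Bornology.cobounded ℂ) :=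
      tendsto_natCast_atTop_cobounded.comp (tendsto_add_atTop_nat 1)
    have h3 : Tendsto (fun x : ℂ => x + (β + 1)) (Bornology.cobounded ℂ)
        (Bornology.cobounded ℂ) := tendsto_add_const_cobounded _
    refine (tendsto_inv₀_cobounded.comp (h3.comp h2)).congr fun k => ?_
    simp [add_assoc]
  have h4 : Tendsto (fun k : ℕ => ‖1 - (((k + 1 : ℕ) : ℂ) + β + 1)⁻¹‖) atTop (𝓝 1) := by
    simpa using (h1.const_sub 1).norm
  refine h4.congr fun k => ?_
  have hk := hβk k
  have hk1 := hβk (k + 1)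
  rw [← norm_div]
  congr 1
  field_simp
  push_cast
  ring

/-- Consecutive multipliers have ratio of modulus tending to `1`, hence so do their `s`-th powers
for every real `s`, including negative ones. A bound for `‖a k‖ R ^ k` with `r < R < 1` then leaves
a series with ratio `r / R`. -/
lemma summable_norm_coeff (hf : f ∈ ClassSigma) (hβ : β ≠ 0)
    (hβk : ∀ k : ℕ, (k : ℂ) + β + 1 ≠ 0) (s : ℝ) {r : ℝ} (hr : 0 < r) (hr1 : r < 1) :
    Summable fun k : ℕ => ‖(β / (k + β + 1)) ^ (s : ℂ) * coeff f k‖ * r ^ k := by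
  obtain ⟨a, ha⟩ := hf
  obtain ⟨R, hrR, hR1⟩ := exists_between hr1
  have hR : 0 < R := hr.trans hrR
  have hRU : (R : ℂ) ∈ Ustar := by
    refine ⟨?_, by simpa using hR.ne'⟩
    rw [mem_U_iff, norm_real, Real.norm_eq_abs, abs_of_pos hR]; exact hR1
  have h1 : Tendsto (fun k : ℕ => ‖a k * (R : ℂ) ^ k‖) atTop (𝓝 0) :=
    (ha.2 _ hRU).summable.norm.tendsto_atTop_zero
  obtain ⟨M, hM⟩ := h1.bddAbove_range
  set b : ℕ → ℝ := fun k => ‖β / (k + β + 1)‖ with hb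
  have hb0 : ∀ k, 0 < b k := fun k => norm_pos_iff.2 (div_ne_zero hβ (hβk k))
  have hx : 0 < r / R := by positivity
  have h2 : Summable fun k : ℕ => b k ^ s * (r / R) ^ k := by
    refine summable_of_ratio_test_tendsto_lt_one (l := r / R) ((div_lt_one hR).2 hrR)
      (Eventually.of_forall fun k => ?_) ?_
    · exact (mul_pos (Real.rpow_pos_of_pos (hb0 k) s) (pow_pos hx k)).ne'
    · have h3 : Tendsto (fun k : ℕ => (b (k + 1) / b k) ^ s * (r / R)) atTop
          (𝓝 (1 ^ s * (r / R))) :=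
        ((tendsto_norm_div_succ β hβ hβk).rpow_const (Or.inl one_ne_zero)).mul_const _
      rw [Real.one_rpow, one_mul] at h3
      refine h3.congr fun k => ?_
      have h5 := Real.rpow_pos_of_pos (hb0 k) s
      have h6 := Real.rpow_pos_of_pos (hb0 (k + 1)) s
      rw [Real.norm_of_nonneg (by positivity), Real.norm_of_nonneg (by positivity),
        Real.div_rpow (hb0 _).le (hb0 _).le, pow_succ]
      field_simp
  refine (h2.mul_left M).of_nonneg_of_le (fun k => by positivity) fun k => ?_
  have h4 : ‖a k‖ * R ^ k ≤ M := by
    have := hM (mem_range_self k)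
    simpa [norm_mul, norm_pow, abs_of_pos hR] using this
  rw [coeff_eq ha, norm_mul, norm_cpow_real]
  have h5 := Real.rpow_pos_of_pos (hb0 k) s
  calc b k ^ s * ‖a k‖ * r ^ k = (‖a k‖ * R ^ k) * (b k ^ s * (r / R) ^ k) := by
        rw [div_pow]; field_simp
    _ ≤ M * (b k ^ s * (r / R) ^ k) := by gcongr

lemma summable_opP (hf : f ∈ ClassSigma) (hβ : β ≠ 0)
    (hβk : ∀ k : ℕ, (k : ℂ) + β + 1 ≠ 0) (s : ℝ) {z : ℂ} (hz : z ∈ Ustar) :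
    Summable fun k : ℕ => (β / (k + β + 1)) ^ (s : ℂ) * coeff f k * z ^ k := by
  refine Summable.of_norm ?_
  simpa only [norm_mul _ (z ^ _), norm_pow] using
    summable_norm_coeff hf hβ hβk s (norm_pos_iff.2 hz.2) (mem_U_iff.1 hz.1)

/-- The recurrence `z (P^s f)' = β P^{s-1} f - (β + 1) P^s f`. -/
lemma hasDerivAt_opP (hf : f ∈ ClassSigma) (hβ : β ≠ 0)
    (hβk : ∀ k : ℕ, (k : ℂ) + β + 1 ≠ 0) (s : ℝ) {z : ℂ} (hz : z ∈ Ustar) :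
    HasDerivAt (opP s β f) ((β * opP (s - 1) β f z - (β + 1) * opP s β f z) / z) z := by
  have hz0 : z ≠ 0 := hz.2
  obtain ⟨r, hzr, hr1⟩ := exists_between (mem_U_iff.1 hz.1)
  have hr : 0 < r := (norm_nonneg z).trans_lt hzr
  set c : ℕ → ℂ := fun k => (β / (k + β + 1)) ^ (s : ℂ) * coeff f k with hc
  have hu := summable_norm_coeff hf hβ hβk s hr hr1
  have hd : ∀ k : ℕ, DifferentiableOn ℂ (fun w : ℂ => c k * w ^ k) (Metric.ball 0 r) :=
    fun k => by fun_prop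
  have hle : ∀ (k : ℕ) (w : ℂ), w ∈ Metric.ball (0 : ℂ) r → ‖c k * w ^ k‖ ≤ ‖c k‖ * r ^ k := by
    intro k w hw
    rw [norm_mul, norm_pow]
    have := (mem_ball_zero_iff.1 hw).le
    gcongr
  have hzb : z ∈ Metric.ball (0 : ℂ) r := mem_ball_zero_iff.2 hzr
  have h1 := (differentiableOn_tsum_of_summable_norm hu hd Metric.isOpen_ball hle).differentiableAt
    (Metric.isOpen_ball.mem_nhds hzb)
  have h2 := (hasSum_deriv_of_summable_norm hu hd Metric.isOpen_ball hle hzb).mul_left z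
  have h3 := ((summable_opP hf hβ hβk (s - 1) hz).hasSum.mul_left β).sub
    ((summable_opP hf hβ hβk s hz).hasSum.mul_left (β + 1))
  -- The recurrence holds coefficientwise: lowering the exponent by one multiplies by `(k + β + 1) /
  -- β`, and `k = (k + β + 1) - (β + 1)`.
  have h4 : (fun k : ℕ => z * deriv (fun w : ℂ => c k * w ^ k) z) = fun k : ℕ =>
      β * ((β / (k + β + 1)) ^ ((s - 1 : ℝ) : ℂ) * coeff f k * z ^ k) -
        (β + 1) * ((β / (k + β + 1)) ^ (s : ℂ) * coeff f k * z ^ k) := by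
    funext k
    have hk := hβk k
    have hb := div_ne_zero hβ hk
    have h5 : deriv (fun w : ℂ => c k * w ^ k) z = c k * (k * z ^ (k - 1)) := by simp
    have h6 : z * (k * z ^ (k - 1)) = k * z ^ k := by
      rcases k with _ | k
      · simp
      · simp only [Nat.add_sub_cancel, pow_succ]; ring
    rw [h5, mul_left_comm, h6, ofReal_sub, ofReal_one, cpow_sub _ _ hb, cpow_one]
    simp only [hc]
    field_simp
    ring
  rw [h4] at h2
  have h7 := h2.unique h3
  have h8 : HasDerivAt (opP s β f) (-(z ^ 2)⁻¹ + deriv (fun w => ∑' k, c k * w ^ k) z) z :=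
    (hasDerivAt_inv hz0).add h1.hasDerivAt
  convert! h8 using 1
  rw [div_eq_iff hz0, add_mul _ _ z, mul_comm (deriv _ z), h7, opP, opP]
  field_simp
  ring

end Operator

/-- `phiExpr` is a linear first order differential expression in `p`. -/
lemma phiExpr_eq {α : ℝ} {β lam μ m l : ℂ} (hβ : β ≠ 0)
    (hβk : ∀ k : ℕ, (k : ℂ) + β + 1 ≠ 0) (hlam : lam ≠ 0) {f p : ℂ → ℂ} (hf : f ∈ ClassSigma)
    (hp : IsPowerBranch (baseFun α β lam f) μ p) {z : ℂ} (hz : z ∈ Ustar) :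
    phiExpr α β lam μ m l f p z = m * p z - l / β * (z * deriv p z) := by
  obtain ⟨L, hL, hLe, hpL⟩ := hp
  have hz0 : z ≠ 0 := hz.2
  have hUz : U ∈ 𝓝 z := isOpen_U.mem_nhds hz.1
  have hLd : HasDerivAt L (deriv L z) z := (hL.differentiableAt hUz).hasDerivAt
  have hpd : HasDerivAt p (p z * (μ * deriv L z)) z := by
    rw [hpL z hz.1]
    refine ((hLd.const_mul μ).cexp).congr_of_eventuallyEq ?_
    filter_upwards [hUz] with x hx using hpL x hx
  have hF1 : HasDerivAt (baseFun α β lam f) (baseFun α β lam f z * deriv L z) z := by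
    rw [← hLe z hz]
    refine hLd.cexp.congr_of_eventuallyEq ?_
    filter_upwards [(isOpen_U.sdiff isClosed_singleton).mem_nhds hz] with x hx
    exact (hLe x hx).symm
  have hP0 := hasDerivAt_opP hf hβ hβk α hz
  have hP1 := hasDerivAt_opP hf hβ hβk (α - 1) hz
  rw [show α - 1 - 1 = α - 2 by ring] at hP1
  have hF2 := ((((hasDerivAt_id' z).const_mul (1 - lam)).fun_mul hP1).fun_add
    (((hasDerivAt_id' z).const_mul lam).fun_mul hP0)).div_const lam
  have hFd := hF1.unique hF2
  have hD : (1 - lam) * opP (α - 1) β f z + lam * opP α β f z ≠ 0 := by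
    intro h
    apply exp_ne_zero (L z)
    rw [hLe z hz, baseFun]
    linear_combination (z / lam) * h
  rw [hpd.deriv, phiExpr]
  -- This is `z F' / F = z L'` with the recurrence inserted; the factor `z` in `F` turns each `z (z
  -- P^s)'` into `β z (P^{s-1} - P^s)`.
  have key : deriv L z * z * ((1 - lam) * opP (α - 1) β f z + lam * opP α β f z) =
      -β * (lam * opP α β f z + (1 - 2 * lam) * opP (α - 1) β f z +
        (lam - 1) * opP (α - 2) β f z) := by
    rw [baseFun] at hFd
    field_simp at hFd
    linear_combination hFd
  have hND : (lam * opP α β f z + (1 - 2 * lam) * opP (α - 1) β f z +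
      (lam - 1) * opP (α - 2) β f z) / ((1 - lam) * opP (α - 1) β f z + lam * opP α β f z) =
      -(deriv L z * z) / β := by
    rw [div_eq_div_iff hD hβ]
    linear_combination key
  rw [hND]
  ring

end MeroSandwich

open MeroSandwich
theorem mainTheorem4
    (α : ℝ) (hα : 0 < α)
    (β lam μ m l : ℂ) (hβ : β ≠ 0) (hβk : ∀ k : ℕ, (k : ℂ) + β + 1 ≠ 0)
    (hlam : lam ≠ 0) (hμ : μ ≠ 0) (hl : l ≠ 0)
    (hre : (m * β / l).re < 0)
    (q : ℂ → ℂ) (hq : IsConvexUnivalent q) (hq0 : q 0 = 1)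
    (f : ℂ → ℂ) (hf : f ∈ ClassSigma)
    (hne : ∀ z ∈ Ustar, baseFun α β lam f z ≠ 0)
    -- `p` is the power `baseFun ^ μ`
    (p : ℂ → ℂ) (hp : IsPowerBranch (baseFun α β lam f) μ p)
    (hpHQ : p ∈ ClassH 1 1 ∩ ClassQ)
    -- `Φ` is given by the formula in `U*`, and is univalent in `U`
    (Φ : ℂ → ℂ) (hΦ : ∀ z ∈ Ustar, Φ z = phiExpr α β lam μ m l f p z)
    (hΦu : IsUnivalent Φ)
    (hsup : Subord (fun z => m * q z - l / β * (z * deriv q z)) Φ) :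
    Subord q p ∧
      IsBestSubordinant (fun r s _ _ => m * r - l / β * s)
        (fun z => m * q z - l / β * (z * deriv q z)) q := by
  -- The general results apply with `c = -(l / β)`.
  have hmc : 0 < (m / (-(l / β))).re := by
    have : m / (-(l / β)) = -(m * β / l) := by field_simp
    rw [this, Complex.neg_re]
    linarith
  have hbest : IsBestSubordinant (fun r s _ _ => m * r - l / β * s)
      (fun z => m * q z - l / β * (z * deriv q z)) q := by
    simpa only [neg_mul, ← sub_eq_add_neg] using hq.isBestSubordinant hmc
  refine ⟨?_, hbest⟩
  obtain ⟨⟨hpd, -⟩, g, hgp, -, hgi, -⟩ := hpHQ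
  have hpu : IsUnivalent p := by
    refine ⟨hpd, fun x hx y hy hxy => ?_⟩
    have hsub : ∀ x ∈ U, x ∈ Metric.closedBall (0 : ℂ) 1 \ excSet p := fun x hx =>
      ⟨Metric.ball_subset_closedBall hx, fun h => (mem_U_iff.1 hx).ne h.1⟩
    exact hgi (hsub x hx) (hsub y hy) (by rw [hgp hx, hgp hy, hxy])
  have hpa := hpd.analyticOnNhd isOpen_U
  have hΦeq : Set.EqOn Φ (fun z => m * p z - l / β * (z * deriv p z)) U := by
    have hc : ContinuousOn (fun z => m * p z - l / β * (z * deriv p z)) U :=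
      (continuousOn_const.mul hpd.continuousOn).sub
        (continuousOn_const.mul (continuousOn_id.mul hpa.deriv.continuousOn))
    intro z hz
    -- The formula for `Φ` is available only off the origin; at `0` both sides are limits of their
    -- values in `U*`.
    obtain rfl | hz0 := eq_or_ne z 0
    · have hU : U ∈ nhds (0 : ℂ) := isOpen_U.mem_nhds hz
      have h1 := (hΦu.1.continuousOn.continuousAt hU).tendsto.mono_left
        (nhdsWithin_le_nhds (s := {0}ᶜ))
      have h2 := (hc.continuousAt hU).tendsto.mono_left (nhdsWithin_le_nhds (s := {0}ᶜ))
      refine tendsto_nhds_unique h1 (h2.congr' ?_)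
      filter_upwards [mem_nhdsWithin_of_mem_nhds hU, self_mem_nhdsWithin] with x hx hx0
      rw [hΦ x ⟨hx, hx0⟩, phiExpr_eq hβ hβk hlam hf hp ⟨hx, hx0⟩]
    · rw [hΦ z ⟨hz, hz0⟩, phiExpr_eq hβ hβk hlam hf hp ⟨hz, hz0⟩]
  refine hbest.2.1.2 p ⟨hpu, ⟨hΦu.1.congr hΦeq.symm, hΦu.2.congr hΦeq⟩, ?_⟩
  obtain ⟨ω, hω, hω0, hω1, hωeq⟩ := hsup
  exact ⟨ω, hω, hω0, hω1, fun z hz => (hωeq z hz).trans (hΦeq (mem_U_iff.2 (hω1 z hz)))⟩
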